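/- Let $X$ be a finite-dimensional real or complex inner product space, with inner product conjugate-linear in the left entry, and extend it to the exterior algebra $\bigwedge X$ by $\langle v_1\wedge\cdots\wedge v_p, w_1\wedge\cdots\wedge w_p\rangle=\det(\langle v_i,w_j\rangle)$, with elements of distinct grades orthogonal; $\|M\|=\sqrt{\langle M,M\rangle}$. The contractions $M\lrcorner N$ and $N\llcorner M$ are the unique elements with $\langle L,M\lrcorner N\rangle=\langle M\wedge L,N\rangle$ and $\langle L,N\llcorner M\rangle=\langle L\wedge M,N\rangle$ for all $L\in\bigwedge X$. A $p$-blade is a product $v_1\wedge\cdots\wedge v_p$ of vectors (any scalar, if $p=0$); the space of a nonzero one is $[v_1\wedge\cdots\wedge v_p]=\mathrm{span}(v_1,\dots,v_p)$ ($\{0\}$ for a scalar). For a nonzero blade $B$, $P_B$ is the algebra homomorphism of $\bigwedge X$ extending the orthogonal projection $X\to[B]$. A multivector has the orientation of $B$ if it equals $kB$ with $k>0$ real. Let $A\in\bigwedge^pX$ and $B\in\bigwedge^qX$ be nonzero blades and $m=\min\{p,q\}$. Take orthonormal bases $(e_1,\dots,e_p)$ of $[A]$ and $(f_1,\dots,f_q)$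 of $[B]$ with $\langle e_i,f_j\rangle=0$ for $i\ne j$ and $\langle e_1,f_1\rangle\ge\cdots\ge\langle e_m,f_m\rangle\ge0$, write $B=B_P\wedge B_\perp$ with $B_P=\epsilon\|B\|f_1\wedge\cdots\wedge f_m$, $|\epsilon|=1$, $B_\perp=f_{m+1}\wedge\cdots\wedge f_q$, and let $\Theta_{[A],[B]}=\arccos\frac{|\langle A,B_P\rangle|}{\|A\|\|B\|}$ (this does not depend on the choices). Then $A$ is partially orthogonal to $B$, i.e. $[A]\cap[B]^\perp\neq\{0\}$, if and only if $A\lrcorner B=0$ and $B\llcorner A=0$. Otherwise $p\le q$ and $\|A\|\|B\|\cos\Theta_{[A],[B]}=\|P_BA\|\|B\|$; moreover $A\lrcorner B$ is the unique $(q-p)$-blade $C$ such that (i) $[C]=[A]^\perp\cap[B]$, (ii) $\|C\|=\|A\|\|B\|\cos\Theta_{[A],[B]}$, (iii) $(P_BA)\wedge C$ has the orientation of $B$; and $B\llcorner A$ is the unique $(q-p)$-blade $C$ satisfying (i), (ii) and (iii') $C\wedge(P_BA)$ has the orientation of $B$. -/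

import Mathlib

open scoped ComplexConjugate InnerProductSpace

namespace Grassmann

noncomputable section

variable {𝕜 X : Type*} [RCLike 𝕜] [NormedAddCommGroup X] [InnerProductSpace 𝕜 X]

/-- For fixed `w₁, …, w_p`, the alternating map `(v₁, …, v_p) ↦ det ⟪w i, v j⟫`. -/
def gramForm {p : ℕ} (w : Fin p → X) : X [⋀^Fin p]→ₗ[𝕜] 𝕜 :=
  Matrix.detRowAlternating.compLinearMap (LinearMap.pi fun i => innerₛₗ 𝕜 (w i))

theorem gramForm_apply {p : ℕ} (w v : Fin p → X) :
    gramForm (𝕜 := 𝕜) w v = (Matrix.of fun i j => ⟪w i, v j⟫_𝕜).det := by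
  rw [← Matrix.det_transpose]
  rfl

/-- The linear functional `⟪w₁ ∧ ⋯ ∧ w_p, ·⟫` on `⋀X`: it is `det ⟪w i, v j⟫` on
`v₁ ∧ ⋯ ∧ v_p`, and zero on the components of grade different from `p`. -/
def bladeFunctional {p : ℕ} (w : Fin p → X) : ExteriorAlgebra 𝕜 X →ₗ[𝕜] 𝕜 :=
  ExteriorAlgebra.liftAlternating (Pi.single p (gramForm w))

theorem bladeFunctional_update_add {p : ℕ} (w : Fin p → X) (i : Fin p) (x y : X) :
    bladeFunctional (𝕜 := 𝕜) (Function.update w i (x + y)) =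
      bladeFunctional (Function.update w i x) + bladeFunctional (Function.update w i y) := by
  have h : gramForm (𝕜 := 𝕜) (Function.update w i (x + y)) =
      gramForm (Function.update w i x) + gramForm (Function.update w i y) := by
    ext v
    have key : ∀ z : X, (Matrix.of fun a b => ⟪Function.update w i z a, v b⟫_𝕜) =
        (Matrix.of fun a b => ⟪w a, v b⟫_𝕜).updateRow i (fun b => ⟪z, v b⟫_𝕜) := by
      intro z
      ext a b
      by_cases hai : a = i
      · subst hai; simp
      · simp [hai]
    rw [AlternatingMap.add_apply, gramForm_apply, gramForm_apply, gramForm_apply, key, key, key,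
      ← Matrix.det_updateRow_add]
    congr 2
    ext b
    simp [inner_add_left]
  rw [bladeFunctional, h, Pi.single_add, map_add]
  rfl

theorem bladeFunctional_update_smul {p : ℕ} (w : Fin p → X) (i : Fin p) (c : 𝕜) (x : X) :
    bladeFunctional (𝕜 := 𝕜) (Function.update w i (c • x)) =
      conj c • bladeFunctional (Function.update w i x) := by
  have h : gramForm (𝕜 := 𝕜) (Function.update w i (c • x)) =
      conj c • gramForm (Function.update w i x) := by
    ext v
    have key : ∀ z : X, (Matrix.of fun a b => ⟪Function.update w i z a, v b⟫_𝕜) =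
        (Matrix.of fun a b => ⟪w a, v b⟫_𝕜).updateRow i (fun b => ⟪z, v b⟫_𝕜) := by
      intro z
      ext a b
      by_cases hai : a = i
      · subst hai; simp
      · simp [hai]
    rw [AlternatingMap.smul_apply, gramForm_apply, gramForm_apply, key, key, smul_eq_mul,
      ← Matrix.det_updateRow_smul]
    congr 2
    ext b
    simp [inner_smul_left]
  rw [bladeFunctional, h, Pi.single_smul, map_smul]
  rfl

theorem bladeFunctional_eq_zero {p : ℕ} (w : Fin p → X) (i j : Fin p) (hw : w i = w j)
    (hij : i ≠ j) : bladeFunctional (𝕜 := 𝕜) w = 0 := by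
  have h : gramForm (𝕜 := 𝕜) w = 0 := by
    ext v
    rw [gramForm_apply]
    exact Matrix.det_zero_of_row_eq hij (by ext b; simp [hw])
  rw [bladeFunctional, h, Pi.single_zero, map_zero]

/-- The linear functional `M ↦ conj ⟪M, N⟫` on `⋀X`. -/
def conjInner (N : ExteriorAlgebra 𝕜 X) : ExteriorAlgebra 𝕜 X →ₗ[𝕜] 𝕜 :=
  ExteriorAlgebra.liftAlternating fun p =>
    { toFun := fun w : Fin p → X => conj (bladeFunctional (𝕜 := 𝕜) w N)
      map_update_add' := by
        intro inst w i x y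
        obtain rfl := Subsingleton.elim inst (instDecidableEqFin p)
        rw [bladeFunctional_update_add, LinearMap.add_apply, map_add]
      map_update_smul' := by
        intro inst w i c x
        obtain rfl := Subsingleton.elim inst (instDecidableEqFin p)
        rw [bladeFunctional_update_smul, LinearMap.smul_apply, smul_eq_mul, map_mul,
          RCLike.conj_conj, smul_eq_mul]
      map_eq_zero_of_eq' := by
        intro w i j hw hij
        rw [bladeFunctional_eq_zero w i j hw hij, LinearMap.zero_apply, map_zero] }

/-- The inner product of multivectors, conjugate-linear in the left entry: it is
`det ⟪v i, w j⟫` for blades `v₁ ∧ ⋯ ∧ v_p`, `w₁ ∧ ⋯ ∧ w_p` of the same grade, and zero for blades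
of distinct grades (see `mvInner_ιMulti` and `mvInner_ιMulti_of_ne`). -/
def mvInner (M N : ExteriorAlgebra 𝕜 X) : 𝕜 := conj (conjInner N M)

theorem mvInner_ιMulti_left {p : ℕ} (v : Fin p → X) (N : ExteriorAlgebra 𝕜 X) :
    mvInner (ExteriorAlgebra.ιMulti 𝕜 p v) N = bladeFunctional v N := by
  rw [mvInner, conjInner, ExteriorAlgebra.liftAlternating_apply_ιMulti]
  exact RCLike.conj_conj _

theorem mvInner_ιMulti {p : ℕ} (v w : Fin p → X) :
    mvInner (ExteriorAlgebra.ιMulti 𝕜 p v) (ExteriorAlgebra.ιMulti 𝕜 p w) =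
      (Matrix.of fun i j => ⟪v i, w j⟫_𝕜).det := by
  rw [mvInner_ιMulti_left, bladeFunctional, ExteriorAlgebra.liftAlternating_apply_ιMulti,
    Pi.single_eq_same, gramForm_apply]

theorem mvInner_ιMulti_of_ne {p q : ℕ} (hpq : p ≠ q) (v : Fin p → X) (w : Fin q → X) :
    mvInner (ExteriorAlgebra.ιMulti 𝕜 p v) (ExteriorAlgebra.ιMulti 𝕜 q w) = 0 := by
  rw [mvInner_ιMulti_left, bladeFunctional, ExteriorAlgebra.liftAlternating_apply_ιMulti,
    Pi.single_eq_of_ne hpq.symm]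
  rfl

theorem mvInner_add_left (M M' N : ExteriorAlgebra 𝕜 X) :
    mvInner (M + M') N = mvInner M N + mvInner M' N := by
  simp [mvInner]

theorem mvInner_smul_left (c : 𝕜) (M N : ExteriorAlgebra 𝕜 X) :
    mvInner (c • M) N = conj c * mvInner M N := by
  simp [mvInner]

theorem mvInner_left_ext {N N' N'' : ExteriorAlgebra 𝕜 X} (c : 𝕜)
    (h : ∀ (p : ℕ) (v : Fin p → X), mvInner (ExteriorAlgebra.ιMulti 𝕜 p v) N =
      mvInner (ExteriorAlgebra.ιMulti 𝕜 p v) N' + c * mvInner (ExteriorAlgebra.ιMulti 𝕜 p v) N'')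
    (M : ExteriorAlgebra 𝕜 X) : mvInner M N = mvInner M N' + c * mvInner M N'' := by
  have hM : M ∈ Submodule.span 𝕜
      (Set.range fun x : Σ n, (Fin n → X) => ExteriorAlgebra.ιMulti 𝕜 x.1 x.2) := by
    rw [ExteriorAlgebra.ιMulti_span]; trivial
  induction hM using Submodule.span_induction with
  | mem x hx => obtain ⟨⟨p, v⟩, rfl⟩ := hx; exact h p v
  | zero => simp [mvInner]
  | add x y _ _ hx hy => simp only [mvInner_add_left, hx, hy]; ring
  | smul a x _ hx => simp only [mvInner_smul_left, hx]; ring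

theorem mvInner_add_right (M N N' : ExteriorAlgebra 𝕜 X) :
    mvInner M (N + N') = mvInner M N + mvInner M N' := by
  have := mvInner_left_ext (N := N + N') (N' := N) (N'' := N') 1
    (fun p v => by simp [mvInner_ιMulti_left]) M
  simpa using this

theorem mvInner_smul_right (c : 𝕜) (M N : ExteriorAlgebra 𝕜 X) :
    mvInner M (c • N) = c * mvInner M N := by
  have := mvInner_left_ext (N := c • N) (N' := 0) (N'' := N) c
    (fun p v => by simp [mvInner_ιMulti_left]) M
  have h0 : mvInner M (0 : ExteriorAlgebra 𝕜 X) = 0 := by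
    have := mvInner_add_right M (0 : ExteriorAlgebra 𝕜 X) 0
    simpa using this
  simpa [h0] using this

/-- The inner product of multivectors as a sesquilinear map. -/
def mvInnerₛₗ : ExteriorAlgebra 𝕜 X →ₗ⋆[𝕜] ExteriorAlgebra 𝕜 X →ₗ[𝕜] 𝕜 :=
  LinearMap.mk₂'ₛₗ (starRingEnd 𝕜) (RingHom.id 𝕜) mvInner mvInner_add_left
    (fun c M N => by simp [mvInner_smul_left]) mvInner_add_right
    (fun c M N => by simp [mvInner_smul_right])

theorem mvInner_basis {n : ℕ} (b : OrthonormalBasis (Fin n) 𝕜 X) (s t : Finset (Fin n)) :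
    mvInner (b.toBasis.ExteriorAlgebra s) (b.toBasis.ExteriorAlgebra t) =
      if s = t then 1 else 0 := by
  rw [ExteriorAlgebra.basis_apply, ExteriorAlgebra.basis_apply]
  by_cases hc : s.card = t.card
  · rw [← ExteriorAlgebra.basis_apply b.toBasis t, ExteriorAlgebra.basis_apply_ofCard b.toBasis hc.symm]
    rw [mvInner_ιMulti]
    split_ifs with h
    · subst h
      convert Matrix.det_one (n := Fin s.card)
      ext i j
      simp [Matrix.one_apply, orthonormal_iff_ite.mp b.orthonormal]
    · have : (Set.powersetCard.ofCard hc.symm) ≠ (Set.powersetCard.ofCard rfl : Set.powersetCard _ s.card) := by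
        intro h'; exact h (congrArg Subtype.val h').symm
      obtain ⟨x, hxt, hxs⟩ := (Set.powersetCard.exists_mem_notMem_iff_ne _ _).mp this
      simp only [Set.mem_range, not_exists,
        ← Set.powersetCard.mem_range_ofFinEmbEquiv_symm_iff_mem] at hxs hxt
      obtain ⟨i, rfl⟩ := hxt
      refine Matrix.det_eq_zero_of_column_eq_zero i fun j => ?_
      simpa using b.orthonormal.inner_eq_zero (hxs j)
  · rw [if_neg (by rintro rfl; exact hc rfl)]
    exact mvInner_ιMulti_of_ne hc _ _

theorem mvInner_basis_left {n : ℕ} (b : OrthonormalBasis (Fin n) 𝕜 X) (s : Finset (Fin n))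
    (C : ExteriorAlgebra 𝕜 X) :
    mvInner (b.toBasis.ExteriorAlgebra s) C = b.toBasis.ExteriorAlgebra.repr C s := by
  have h : mvInnerₛₗ (b.toBasis.ExteriorAlgebra s) = b.toBasis.ExteriorAlgebra.coord s := by
    refine b.toBasis.ExteriorAlgebra.ext fun t => ?_
    change mvInner _ _ = _
    rw [mvInner_basis, Module.Basis.coord_apply, Module.Basis.repr_self, Finsupp.single_apply]
    simp only [eq_comm]
  exact LinearMap.congr_fun h C

/-- Riesz representation for the inner product of multivectors. -/
theorem existsUnique_mvInner_eq [FiniteDimensional 𝕜 X] (ψ : ExteriorAlgebra 𝕜 X →ₗ⋆[𝕜] 𝕜) :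
    ∃! C : ExteriorAlgebra 𝕜 X, ∀ L, mvInner L C = ψ L := by
  let b := stdOrthonormalBasis 𝕜 X
  refine ⟨∑ s, ψ (b.toBasis.ExteriorAlgebra s) • b.toBasis.ExteriorAlgebra s, fun L => ?_,
    fun C hC => ?_⟩
  · have h : mvInnerₛₗ.flip (∑ s, ψ (b.toBasis.ExteriorAlgebra s) • b.toBasis.ExteriorAlgebra s)
        = ψ := by
      refine b.toBasis.ExteriorAlgebra.ext fun t => ?_
      change mvInner _ _ = _
      rw [mvInner_basis_left, Module.Basis.repr_sum_self]
    exact LinearMap.congr_fun h L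
  · refine b.toBasis.ExteriorAlgebra.ext_elem fun s => ?_
    rw [← mvInner_basis_left, hC, Module.Basis.repr_sum_self]

theorem existsUnique_leftContraction [FiniteDimensional 𝕜 X] (M N : ExteriorAlgebra 𝕜 X) :
    ∃! C : ExteriorAlgebra 𝕜 X, ∀ L, mvInner L C = mvInner (M * L) N :=
  existsUnique_mvInner_eq ((mvInnerₛₗ.flip N).comp (LinearMap.mulLeft 𝕜 M))

theorem existsUnique_rightContraction [FiniteDimensional 𝕜 X] (N M : ExteriorAlgebra 𝕜 X) :
    ∃! C : ExteriorAlgebra 𝕜 X, ∀ L, mvInner L C = mvInner (L * M) N :=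
  existsUnique_mvInner_eq ((mvInnerₛₗ.flip N).comp (LinearMap.mulRight 𝕜 M))

/-- The left contraction `M ⌋ N` of the contractor `M` on the contractee `N`: the unique
multivector with `⟪L, M ⌋ N⟫ = ⟪M ∧ L, N⟫` for all `L`. -/
def leftContraction [FiniteDimensional 𝕜 X] (M N : ExteriorAlgebra 𝕜 X) : ExteriorAlgebra 𝕜 X :=
  (existsUnique_leftContraction M N).choose

/-- The right contraction `N ⌊ M` of the contractee `N` by the contractor `M`: the unique
multivector with `⟪L, N ⌊ M⟫ = ⟪L ∧ M, N⟫` for all `L`. -/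
def rightContraction [FiniteDimensional 𝕜 X] (N M : ExteriorAlgebra 𝕜 X) : ExteriorAlgebra 𝕜 X :=
  (existsUnique_rightContraction N M).choose

/-- The norm `‖M‖ = √⟪M, M⟫` of a multivector. -/
def mvNorm (M : ExteriorAlgebra 𝕜 X) : ℝ := √(RCLike.re (mvInner M M))

/-- `B` is a `p`-blade. The scalar factor `c` is redundant for `p ≥ 1`; for `p = 0` it makes every
scalar a `0`-blade. -/
def IsBlade (p : ℕ) (B : ExteriorAlgebra 𝕜 X) : Prop :=
  ∃ (c : 𝕜) (v : Fin p → X), B = c • ExteriorAlgebra.ιMulti 𝕜 p v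

/-- The space `[B]` of a nonzero blade `B`: the span of the vectors `v₁, …, v_p` in any
factorization `B = c • v₁ ∧ ⋯ ∧ v_p`. All factorizations of a nonzero blade have the same span
(see `bladeSpace_eq_span`), so the infimum is over a one-element set. -/
def bladeSpace (B : ExteriorAlgebra 𝕜 X) : Submodule 𝕜 X :=
  sInf {V | ∃ (p : ℕ) (c : 𝕜) (v : Fin p → X),
    B = c • ExteriorAlgebra.ιMulti 𝕜 p v ∧ V = Submodule.span 𝕜 (Set.range v)}

theorem mem_span_iff_ι_mul_eq_zero {p : ℕ} {v : Fin p → X}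
    (hv : ExteriorAlgebra.ιMulti 𝕜 p v ≠ 0) (x : X) :
    x ∈ Submodule.span 𝕜 (Set.range v) ↔
      ExteriorAlgebra.ι 𝕜 x * ExteriorAlgebra.ιMulti 𝕜 p v = 0 := by
  have hcons : ExteriorAlgebra.ι 𝕜 x * ExteriorAlgebra.ιMulti 𝕜 p v =
      ExteriorAlgebra.ιMulti 𝕜 (p + 1) (Fin.cons x v) := by
    rw [ExteriorAlgebra.ιMulti_succ_apply]
    simp [Matrix.vecTail, Function.comp_def]
  have hind : LinearIndependent 𝕜 v := by
    by_contra h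
    exact hv (AlternatingMap.map_linearDependent _ v h)
  rw [hcons]
  constructor
  · intro hx
    refine AlternatingMap.map_linearDependent _ _ fun h => ?_
    exact (linearIndependent_finCons.mp h).2 hx
  · intro h0
    by_contra hx
    have hli := linearIndependent_finCons.mpr ⟨hind, hx⟩
    have h1 := (exteriorPower.ιMulti_family_linearIndependent_field (n := p + 1) hli).ne_zero
      (Set.powersetCard.ofCard (Finset.card_fin (p + 1)))
    apply h1
    apply Subtype.ext
    rw [exteriorPower.ιMulti_family_apply_coe]
    have hid : ⇑(Set.powersetCard.ofFinEmbEquiv.symm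
        (Set.powersetCard.ofCard (Finset.card_fin (p + 1)))) = (id : Fin (p + 1) → Fin (p + 1)) := by
      rw [Set.powersetCard.ofFinEmbEquiv_symm_apply]
      exact (Finset.orderEmbOfFin_unique _ (fun _ => Finset.mem_univ _) strictMono_id).symm
    rw [ExteriorAlgebra.ιMulti_family, hid]
    exact h0

/-- The space of a nonzero blade is the span of the vectors in any of its factorizations. -/
theorem bladeSpace_eq_span {p : ℕ} {c : 𝕜} {v : Fin p → X}
    (h : c • ExteriorAlgebra.ιMulti 𝕜 p v ≠ 0) :
    bladeSpace (c • ExteriorAlgebra.ιMulti 𝕜 p v) = Submodule.span 𝕜 (Set.range v) := by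
  refine le_antisymm (sInf_le ⟨p, c, v, rfl, rfl⟩) (le_sInf ?_)
  rintro V ⟨q, d, w, hw, rfl⟩ x hx
  have hd : d ≠ 0 ∧ ExteriorAlgebra.ιMulti 𝕜 q w ≠ 0 := by
    rw [hw] at h; exact smul_ne_zero_iff.mp h
  rw [mem_span_iff_ι_mul_eq_zero (smul_ne_zero_iff.mp h).2] at hx
  rw [mem_span_iff_ι_mul_eq_zero hd.2]
  have : d • (ExteriorAlgebra.ι 𝕜 x * ExteriorAlgebra.ιMulti 𝕜 q w) = 0 := by
    rw [← mul_smul_comm, ← hw, mul_smul_comm, hx, smul_zero]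
  exact (smul_eq_zero.mp this).resolve_left hd.1

/-- `A` and `B` have the same orientation: `A = k B` with `k > 0` real, also over `ℂ`. -/
def SameOrientation (A B : ExteriorAlgebra 𝕜 X) : Prop :=
  ∃ k : ℝ, 0 < k ∧ A = (k : 𝕜) • B

/-- The subspace `V` is partially orthogonal to the subspace `W`. -/
def PartiallyOrthogonal (V W : Submodule 𝕜 X) : Prop := V ⊓ Wᗮ ≠ ⊥

/-- The extension to `⋀X` of the orthogonal projection of `X` onto `V`, with `1 ↦ 1` and
`v₁ ∧ ⋯ ∧ v_p ↦ P v₁ ∧ ⋯ ∧ P v_p`. -/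
def mvProj [FiniteDimensional 𝕜 X] (V : Submodule 𝕜 X) :
    ExteriorAlgebra 𝕜 X →ₐ[𝕜] ExteriorAlgebra 𝕜 X :=
  ExteriorAlgebra.map (V.starProjection : X →ₗ[𝕜] X)

/-- The `k`-th angle between the families `e` and `f`, for `k < min p q`. -/
def pairAngle (𝕜 : Type*) {X : Type*} [RCLike 𝕜] [NormedAddCommGroup X] [InnerProductSpace 𝕜 X]
    {p q : ℕ} (e : Fin p → X) (f : Fin q → X) (k : Fin (min p q)) : ℝ :=
  Real.arccos (RCLike.re
    ⟪e (Fin.castLE (min_le_left p q) k), f (Fin.castLE (min_le_right p q) k)⟫_𝕜)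

/-- `e` and `f` are associated principal bases of the subspaces `V` and `W`. If `V` or `W` is zero
this says only that `e` and `f` are orthonormal bases of `V` and `W`. -/
structure IsPrincipalBases {p q : ℕ} (V W : Submodule 𝕜 X) (e : Fin p → X) (f : Fin q → X) :
    Prop where
  orthonormal_left : Orthonormal 𝕜 e
  span_left : Submodule.span 𝕜 (Set.range e) = V
  orthonormal_right : Orthonormal 𝕜 f
  span_right : Submodule.span 𝕜 (Set.range f) = W
  inner_eq_zero : ∀ (i : Fin p) (j : Fin q), (i : ℕ) ≠ j → ⟪e i, f j⟫_𝕜 = 0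
  inner_nonneg : ∀ (i : Fin p) (j : Fin q), (i : ℕ) = j →
    0 ≤ RCLike.re ⟪e i, f j⟫_𝕜 ∧ RCLike.im ⟪e i, f j⟫_𝕜 = 0
  monotone_angle : Monotone (pairAngle 𝕜 e f)

/-- `B = P ∧ Q` is a projective-orthogonal factorization of the nonzero blade `B` with respect to
the nonzero blade `A`: for a principal basis `f₁, …, f_q` of `[B]` with respect to `[A]`,
`m = min p q` and a unit scalar `ε`, one has `P = ε ‖B‖ f₁ ∧ ⋯ ∧ f_m` and
`Q = f_{m+1} ∧ ⋯ ∧ f_q`. -/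
def IsPOFactorization (A B P Q : ExteriorAlgebra 𝕜 X) : Prop :=
  ∃ (p q : ℕ) (e : Fin p → X) (f : Fin q → X) (ε : 𝕜),
    IsPrincipalBases (bladeSpace A) (bladeSpace B) e f ∧ ‖ε‖ = 1 ∧
    P = (ε * (mvNorm B : 𝕜)) •
      ExteriorAlgebra.ιMulti 𝕜 (min p q) (fun i => f (Fin.castLE (min_le_right p q) i)) ∧
    Q = ExteriorAlgebra.ιMulti 𝕜 (q - min p q)
      (fun i => f ⟨min p q + i, by have := i.isLt; omega⟩) ∧
    B = P * Q

open Classical in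
/-- The asymmetric angle `Θ_{[A],[B]} = arccos (|⟪A, B_P⟫| / (‖A‖ ‖B‖))` of `[A]` with `[B]`, for
nonzero blades `A` and `B` and a projective-orthogonal factorization `B = B_P ∧ B_⊥` with respect
to `A` (one exists, and the angle does not depend on its choice). -/
def asymmetricAngle (A B : ExteriorAlgebra 𝕜 X) : ℝ :=
  if h : ∃ P Q, IsPOFactorization A B P Q then
    Real.arccos (‖mvInner A h.choose‖ / (mvNorm A * mvNorm B))
  else 0

end

end Grassmann

open Grassmann

/-!
Let `D` be the projection of `A` to `[B]`. Projecting is injective on `[A]` exactly when `[A]`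
meets `[B]ᗮ` trivially, so `D = 0` means that `A` is partially orthogonal to `B`, and then
`⟪A ∧ L, B⟫ = ⟪D ∧ P_B L, B⟫ = 0` for all `L`. If `D ≠ 0`, then `[D] ≤ [B]` and `B = D ∧ H` for a
blade `H` of `[D]ᗮ ⊓ [B] = [A]ᗮ ⊓ [B]`. As `[A] ⟂ [H]`, Gram determinants are block triangular, so
`⟪A ∧ L, D ∧ H⟫ = ⟪A, D⟫ ⟪L, H⟫`, that is, `A ⌋ B = ‖D‖² H`; in particular `D ∧ (A ⌋ B) = ‖D‖² B`,
and `‖B‖ = ‖D‖ ‖H‖` gives `‖A ⌋ B‖ = ‖D‖ ‖B‖`. A blade is determined up to a scalar by its space,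
the norm makes the scalar unimodular, and the orientation makes it `1`. The right contraction
differs from the left one by the sign `(-1) ^ (p * (q - p))`.

For the angle, principal bases are singular vectors of the projection `[A] → [B]`. It maps `e i` to
a multiple of `f i`, so `D` is a multiple of `B_P` and `|⟪A, B_P⟫| = |⟪D, B_P⟫| = ‖D‖ ‖B‖`.
-/

namespace Grassmann

open ExteriorAlgebra Module

section CommRing

variable {R M : Type*} [CommRing R] [AddCommGroup M] [Module R M]

theorem span_range_coe_basis {ι : Type*} {U : Submodule R M} (b : Basis ι R U) :
    Submodule.span R (Set.range fun i => (b i : M)) = U := by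
  have h := congrArg (Submodule.map U.subtype) b.span_eq
  rwa [Submodule.map_span, ← Set.range_comp, Submodule.map_top, Submodule.range_subtype] at h

theorem ι_mul_ιMulti_comm {r : ℕ} (x : M) (v : Fin r → M) :
    ι R x * ιMulti R r v = (-1 : R) ^ r • (ιMulti R r v * ι R x) := by
  induction r with
  | zero => simp
  | succ r ih =>
    have h : ι R x * ι R (v 0) = -(ι R (v 0) * ι R x) :=
      eq_neg_of_add_eq_zero_left (ι_add_mul_swap x (v 0))
    rw [ιMulti_succ_apply, ← mul_assoc, h, neg_mul, mul_assoc, ih, pow_succ]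
    simp [mul_assoc]

theorem ιMulti_mul_ιMulti_comm {p r : ℕ} (v : Fin p → M) (w : Fin r → M) :
    ιMulti R p v * ιMulti R r w = (-1 : R) ^ (p * r) • (ιMulti R r w * ιMulti R p v) := by
  induction p with
  | zero => simp
  | succ p ih =>
    rw [ιMulti_succ_apply, mul_assoc, ih, mul_smul_comm, ← mul_assoc, ι_mul_ιMulti_comm,
      smul_mul_assoc, smul_smul, mul_assoc, ← pow_add]
    ring_nf

theorem exists_ιMulti_eq_smul {p : ℕ} {v w : Fin p → M} (hw : LinearIndependent R w)
    (hv : ∀ i, v i ∈ Submodule.span R (Set.range w)) :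
    ∃ c : R, ιMulti R p v = c • ιMulti R p w := by
  let U := Submodule.span R (Set.range w)
  let b : Basis (Fin p) R U := Basis.span hw
  have hb (i) : (b i : M) = w i := congrArg Subtype.val (Basis.span_apply hw i)
  have ιMulti_eq_det : (ιMulti R p).compLinearMap U.subtype =
      (LinearMap.toSpanSingleton R _ (ιMulti R p w)).compAlternatingMap b.det := by
    refine Basis.ext_alternating b fun σ hσ => ?_
    let τ : Equiv.Perm (Fin p) := Equiv.ofBijective σ (Finite.injective_iff_bijective.mp hσ)
    change AlternatingMap.compLinearMap _ _ (b ∘ τ) = LinearMap.compAlternatingMap _ _ (b ∘ τ)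
    rw [AlternatingMap.map_perm, AlternatingMap.map_perm]
    congr 1
    simp [Basis.det_self, hb, U]
  refine ⟨b.det fun i => ⟨v i, hv i⟩, ?_⟩
  exact DFunLike.congr_fun ιMulti_eq_det fun i => ⟨v i, hv i⟩

theorem ιMulti_comp_cast {m n : ℕ} (h : m = n) (v : Fin n → M) :
    ιMulti R m (v ∘ Fin.cast h) = ιMulti R n v := by
  subst h
  rfl

end CommRing

section Field

variable {K V : Type*} [Field K] [AddCommGroup V] [Module K V]

theorem ιMulti_ne_zero_iff {p : ℕ} {v : Fin p → V} :
    ιMulti K p v ≠ 0 ↔ LinearIndependent K v := by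
  refine ⟨fun hv => not_not.mp (mt ((ιMulti K p).map_linearDependent v) hv), fun hv h0 => ?_⟩
  obtain ⟨g, hg⟩ := (Fintype.linearCombination K v).exists_leftInverse_of_injective
    (LinearMap.ker_eq_bot.mpr hv.fintypeLinearCombination_injective)
  let δ : V [⋀^Fin p]→ₗ[K] K := Matrix.detRowAlternating.compLinearMap g
  have hgv : (fun i => g (v i)) = (1 : Matrix (Fin p) (Fin p) K) := by
    ext i j
    have := congrFun (LinearMap.congr_fun hg (Pi.single i 1)) j
    simpa [Matrix.one_apply, Pi.single_apply, eq_comm] using this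
  have hδv : δ v = 1 := (congrArg Matrix.det hgv).trans Matrix.det_one
  have hδ : liftAlternating (Pi.single p δ) (ιMulti K p v) = δ v := by
    rw [liftAlternating_apply_ιMulti, Pi.single_eq_same]
  rw [h0, map_zero, hδv] at hδ
  exact zero_ne_one hδ

end Field

variable {𝕜 X : Type*} [RCLike 𝕜] [NormedAddCommGroup X] [InnerProductSpace 𝕜 X]

section Blade

variable {p q : ℕ} {A B : ExteriorAlgebra 𝕜 X}

theorem isBlade_ιMulti (v : Fin p → X) : IsBlade p (ιMulti 𝕜 p v) :=
  ⟨1, v, (one_smul _ _).symm⟩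

theorem IsBlade.smul (hA : IsBlade p A) (c : 𝕜) : IsBlade p (c • A) := by
  obtain ⟨d, v, rfl⟩ := hA
  exact ⟨c * d, v, smul_smul _ _ _⟩

theorem IsBlade.mul (hA : IsBlade p A) (hB : IsBlade q B) : IsBlade (p + q) (A * B) := by
  obtain ⟨c, v, rfl⟩ := hA
  obtain ⟨d, w, rfl⟩ := hB
  exact ⟨c * d, Fin.append v w, by rw [smul_mul_smul_comm, ιMulti_mul_ιMulti]⟩

theorem IsBlade.mul_comm (hA : IsBlade p A) (hB : IsBlade q B) :
    A * B = (-1 : 𝕜) ^ (p * q) • (B * A) := by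
  obtain ⟨c, v, rfl⟩ := hA
  obtain ⟨d, w, rfl⟩ := hB
  rw [smul_mul_smul_comm, smul_mul_smul_comm, ιMulti_mul_ιMulti_comm, smul_comm, _root_.mul_comm c]

theorem bladeSpace_smul {c : 𝕜} (hA : IsBlade p A) (hA0 : A ≠ 0) (hc : c ≠ 0) :
    bladeSpace (c • A) = bladeSpace A := by
  obtain ⟨d, v, rfl⟩ := hA
  rw [bladeSpace_eq_span hA0, smul_smul, bladeSpace_eq_span]
  rw [← smul_smul]
  exact smul_ne_zero hc hA0

theorem bladeSpace_ιMulti {v : Fin p → X} (hv : LinearIndependent 𝕜 v) :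
    bladeSpace (ιMulti 𝕜 p v) = Submodule.span 𝕜 (Set.range v) := by
  have h := bladeSpace_eq_span (c := (1 : 𝕜)) (v := v) (by rwa [one_smul, ιMulti_ne_zero_iff])
  rwa [one_smul] at h

theorem IsBlade.exists_linearIndependent (hA : IsBlade p A) (hA0 : A ≠ 0) :
    ∃ (c : 𝕜) (v : Fin p → X), c ≠ 0 ∧ LinearIndependent 𝕜 v ∧ A = c • ιMulti 𝕜 p v := by
  obtain ⟨c, v, rfl⟩ := hA
  obtain ⟨hc, hv⟩ := smul_ne_zero_iff.mp hA0
  exact ⟨c, v, hc, ιMulti_ne_zero_iff.mp hv, rfl⟩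

theorem IsBlade.finrank_bladeSpace (hA : IsBlade p A) (hA0 : A ≠ 0) :
    finrank 𝕜 (bladeSpace A) = p := by
  obtain ⟨c, v, -, hv, rfl⟩ := hA.exists_linearIndependent hA0
  rw [bladeSpace_eq_span hA0, finrank_span_eq_card hv, Fintype.card_fin]

theorem IsBlade.finiteDimensional_bladeSpace (hA : IsBlade p A) (hA0 : A ≠ 0) :
    FiniteDimensional 𝕜 (bladeSpace A) := by
  obtain ⟨c, v, rfl⟩ := hA
  rw [bladeSpace_eq_span hA0]
  exact FiniteDimensional.span_of_finite 𝕜 (Set.finite_range v)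

theorem IsBlade.eq_of_span_eq_bladeSpace {n : ℕ} (hA : IsBlade p A) (hA0 : A ≠ 0)
    {v : Fin n → X} (hv : LinearIndependent 𝕜 v)
    (hAv : Submodule.span 𝕜 (Set.range v) = bladeSpace A) : n = p := by
  rw [← hA.finrank_bladeSpace hA0, ← hAv, finrank_span_eq_card hv, Fintype.card_fin]

theorem IsBlade.exists_eq_smul_ιMulti (hA : IsBlade p A) (hA0 : A ≠ 0) {w : Fin p → X}
    (hw : LinearIndependent 𝕜 w) (hAw : bladeSpace A = Submodule.span 𝕜 (Set.range w)) :
    ∃ c : 𝕜, c ≠ 0 ∧ A = c • ιMulti 𝕜 p w := by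
  obtain ⟨c, v, rfl⟩ := hA
  rw [bladeSpace_eq_span hA0] at hAw
  obtain ⟨d, hd⟩ := exists_ιMulti_eq_smul hw
    fun i => hAw ▸ Submodule.subset_span (Set.mem_range_self i)
  rw [hd, smul_smul] at hA0 ⊢
  exact ⟨c * d, (smul_ne_zero_iff.mp hA0).1, rfl⟩

theorem IsBlade.exists_eq_smul_of_bladeSpace_eq (hA : IsBlade p A) (hA0 : A ≠ 0)
    (hB : IsBlade p B) (hB0 : B ≠ 0) (hAB : bladeSpace A = bladeSpace B) :
    ∃ c : 𝕜, c ≠ 0 ∧ A = c • B := by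
  obtain ⟨d, w, hd, hw, rfl⟩ := hB.exists_linearIndependent hB0
  obtain ⟨c, hc, rfl⟩ := hA.exists_eq_smul_ιMulti hA0 hw (hAB.trans (bladeSpace_eq_span hB0))
  exact ⟨c * d⁻¹, mul_ne_zero hc (inv_ne_zero hd), by rw [smul_smul, inv_mul_cancel_right₀ hd]⟩

theorem IsBlade.exists_orthonormal (hA : IsBlade p A) (hA0 : A ≠ 0) :
    ∃ (c : 𝕜) (e : Fin p → X), Orthonormal 𝕜 e ∧ A = c • ιMulti 𝕜 p e := by
  have := hA.finiteDimensional_bladeSpace hA0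
  let b := (stdOrthonormalBasis 𝕜 (bladeSpace A)).reindex
    (finCongr (hA.finrank_bladeSpace hA0))
  have hb : Orthonormal 𝕜 fun i => (b i : X) :=
    b.orthonormal.comp_linearIsometry (bladeSpace A).subtypeₗᵢ
  obtain ⟨c, -, hc⟩ := hA.exists_eq_smul_ιMulti hA0 hb.linearIndependent
    (span_range_coe_basis b.toBasis).symm
  exact ⟨c, _, hb, hc⟩

end Blade

section Inner

variable {p q r : ℕ} {A B D H L : ExteriorAlgebra 𝕜 X}

theorem mvInner_zero_right (M : ExteriorAlgebra 𝕜 X) : mvInner M (0 : ExteriorAlgebra 𝕜 X) = 0 :=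
  map_zero (mvInnerₛₗ M)

theorem mvInner_zero_left (N : ExteriorAlgebra 𝕜 X) : mvInner (0 : ExteriorAlgebra 𝕜 X) N = 0 :=
  LinearMap.map_zero₂ mvInnerₛₗ N

theorem mvNorm_zero : mvNorm (0 : ExteriorAlgebra 𝕜 X) = 0 := by
  rw [mvNorm, mvInner_zero_right, map_zero, Real.sqrt_zero]

theorem mvNorm_nonneg (M : ExteriorAlgebra 𝕜 X) : 0 ≤ mvNorm M :=
  Real.sqrt_nonneg _

theorem mvNorm_smul (c : 𝕜) (M : ExteriorAlgebra 𝕜 X) : mvNorm (c • M) = ‖c‖ * mvNorm M := by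
  have h : RCLike.re (mvInner (c • M) (c • M)) = ‖c‖ ^ 2 * RCLike.re (mvInner M M) := by
    rw [mvInner_smul_left, mvInner_smul_right, ← mul_assoc, RCLike.conj_mul, ← RCLike.ofReal_pow,
      RCLike.re_ofReal_mul]
  rw [mvNorm, h, Real.sqrt_mul (sq_nonneg _), Real.sqrt_sq (norm_nonneg _), mvNorm]

theorem mvInner_ιMulti_self_of_orthonormal {e : Fin p → X} (he : Orthonormal 𝕜 e) :
    mvInner (ιMulti 𝕜 p e) (ιMulti 𝕜 p e) = 1 := by
  have gram_eq_one : (Matrix.of fun i j => ⟪e i, e j⟫_𝕜) = 1 := by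
    ext i j
    simp [Matrix.one_apply, orthonormal_iff_ite.mp he]
  rw [mvInner_ιMulti, gram_eq_one, Matrix.det_one]

theorem mvNorm_ιMulti_of_orthonormal {e : Fin p → X} (he : Orthonormal 𝕜 e) :
    mvNorm (ιMulti 𝕜 p e) = 1 := by
  rw [mvNorm, mvInner_ιMulti_self_of_orthonormal he, RCLike.one_re, Real.sqrt_one]

theorem IsBlade.mvInner_self (hA : IsBlade p A) : mvInner A A = (mvNorm A : 𝕜) ^ 2 := by
  rcases eq_or_ne A 0 with rfl | hA0
  · simp [mvInner_zero_right, mvNorm_zero]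
  obtain ⟨c, e, he, rfl⟩ := hA.exists_orthonormal hA0
  rw [mvNorm_smul, mvNorm_ιMulti_of_orthonormal he, mvInner_smul_left, mvInner_smul_right,
    mvInner_ιMulti_self_of_orthonormal he, mul_one, mul_one, RCLike.conj_mul]

theorem IsBlade.mvNorm_pos (hA : IsBlade p A) (hA0 : A ≠ 0) : 0 < mvNorm A := by
  obtain ⟨c, e, he, rfl⟩ := hA.exists_orthonormal hA0
  rw [mvNorm_smul, mvNorm_ιMulti_of_orthonormal he, mul_one]
  exact norm_pos_iff.mpr (smul_ne_zero_iff.mp hA0).1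

theorem IsBlade.exists_eq_mvNorm_smul_ιMulti (hA : IsBlade p A) (hA0 : A ≠ 0)
    {e : Fin p → X} (he : Orthonormal 𝕜 e)
    (hAe : Submodule.span 𝕜 (Set.range e) = bladeSpace A) :
    ∃ ε : 𝕜, ‖ε‖ = 1 ∧ A = (ε * (mvNorm A : 𝕜)) • ιMulti 𝕜 p e := by
  obtain ⟨c, hc, rfl⟩ := hA.exists_eq_smul_ιMulti hA0 he.linearIndependent hAe.symm
  have norm_c : ‖c‖ ≠ 0 := norm_ne_zero_iff.mpr hc
  refine ⟨c / (‖c‖ : 𝕜), by rw [norm_div, RCLike.norm_ofReal, abs_norm, div_self norm_c], ?_⟩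
  rw [mvNorm_smul, mvNorm_ιMulti_of_orthonormal he, mul_one,
    div_mul_cancel₀ _ (RCLike.ofReal_ne_zero.mpr norm_c)]

theorem mvInner_eq_zero_of_ne (hpq : p ≠ q) (hA : IsBlade p A) (hB : IsBlade q B) :
    mvInner A B = 0 := by
  obtain ⟨c, v, rfl⟩ := hA
  obtain ⟨d, w, rfl⟩ := hB
  rw [mvInner_smul_left, mvInner_smul_right, mvInner_ιMulti_of_ne hpq, mul_zero, mul_zero]

theorem mvInner_ιMulti_mul_ιMulti {v g : Fin p → X} {w h : Fin r → X}
    (hvh : ∀ i j, ⟪v i, h j⟫_𝕜 = 0) :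
    mvInner (ιMulti 𝕜 p v * ιMulti 𝕜 r w) (ιMulti 𝕜 p g * ιMulti 𝕜 r h) =
      mvInner (ιMulti 𝕜 p v) (ιMulti 𝕜 p g) * mvInner (ιMulti 𝕜 r w) (ιMulti 𝕜 r h) := by
  have gram_eq_fromBlocks :
      Matrix.reindex (finSumFinEquiv (m := p) (n := r)).symm finSumFinEquiv.symm
        (Matrix.of fun i j => ⟪Fin.append v w i, Fin.append g h j⟫_𝕜) =
      Matrix.fromBlocks (Matrix.of fun i j => ⟪v i, g j⟫_𝕜) 0
        (Matrix.of fun i j => ⟪w i, g j⟫_𝕜) (Matrix.of fun i j => ⟪w i, h j⟫_𝕜) := by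
    ext (i | i) (j | j) <;> simp [hvh]
  simp only [ιMulti_mul_ιMulti, mvInner_ιMulti]
  rw [← Matrix.det_reindex_self (finSumFinEquiv (m := p)).symm, gram_eq_fromBlocks,
    Matrix.det_fromBlocks_zero₁₂]

theorem mvInner_mul_mul_of_isOrtho (hA : IsBlade p A) (hA0 : A ≠ 0) (hD : IsBlade p D)
    (hH : IsBlade r H) (hH0 : H ≠ 0) (hL : IsBlade q L) (hAH : bladeSpace A ⟂ bladeSpace H) :
    mvInner (A * L) (D * H) = mvInner A D * mvInner L H := by
  rcases ne_or_eq q r with hqr | rfl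
  · rw [mvInner_eq_zero_of_ne hqr hL hH,
      mvInner_eq_zero_of_ne (by omega) (hA.mul hL) (hD.mul hH), mul_zero]
  obtain ⟨a, v, rfl⟩ := hA
  obtain ⟨d, g, rfl⟩ := hD
  obtain ⟨c, h, rfl⟩ := hH
  obtain ⟨l, w, rfl⟩ := hL
  rw [bladeSpace_eq_span hA0, bladeSpace_eq_span hH0, Submodule.isOrtho_span] at hAH
  simp only [smul_mul_smul_comm, mvInner_smul_left, mvInner_smul_right,
    mvInner_ιMulti_mul_ιMulti fun i j => hAH ⟨i, rfl⟩ ⟨j, rfl⟩, map_mul]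
  ring

theorem mvNorm_mul_of_isOrtho (hA : IsBlade p A) (hA0 : A ≠ 0) (hH : IsBlade r H) (hH0 : H ≠ 0)
    (hAH : bladeSpace A ⟂ bladeSpace H) : mvNorm (A * H) = mvNorm A * mvNorm H := by
  have h : mvInner (A * H) (A * H) = ((mvNorm A * mvNorm H) ^ 2 : ℝ) := by
    rw [mvInner_mul_mul_of_isOrtho hA hA0 hA hH hH0 hH hAH, hA.mvInner_self, hH.mvInner_self]
    push_cast
    ring
  rw [mvNorm, h, RCLike.ofReal_re, Real.sqrt_sq]
  exact mul_nonneg (mvNorm_nonneg _) (mvNorm_nonneg _)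

theorem mvInner_self_nonneg [FiniteDimensional 𝕜 X] (M : ExteriorAlgebra 𝕜 X) :
    0 ≤ RCLike.re (mvInner M M) := by
  let b := (stdOrthonormalBasis 𝕜 X).toBasis.ExteriorAlgebra
  have mvInner_eq_sum : mvInner M M = ∑ s, conj (b.repr M s) * b.repr M s := by
    conv_lhs => enter [1]; rw [← b.sum_repr M]
    change mvInnerₛₗ _ M = _
    rw [map_sum, LinearMap.sum_apply]
    refine Finset.sum_congr rfl fun s _ => ?_
    rw [← mvInner_basis_left]
    exact mvInner_smul_left _ _ _
  rw [mvInner_eq_sum, map_sum]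
  refine Finset.sum_nonneg fun s _ => ?_
  rw [RCLike.conj_mul, ← RCLike.ofReal_pow, RCLike.ofReal_re]
  exact sq_nonneg _

end Inner

section Contraction

variable [FiniteDimensional 𝕜 X]

theorem mvInner_leftContraction (L M N : ExteriorAlgebra 𝕜 X) :
    mvInner L (leftContraction M N) = mvInner (M * L) N :=
  (existsUnique_leftContraction M N).choose_spec.1 L

theorem mvInner_rightContraction (L M N : ExteriorAlgebra 𝕜 X) :
    mvInner L (rightContraction N M) = mvInner (L * M) N :=
  (existsUnique_rightContraction N M).choose_spec.1 L

theorem leftContraction_eq_of_forall_ιMulti {M N C : ExteriorAlgebra 𝕜 X}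
    (h : ∀ (r : ℕ) (v : Fin r → X), mvInner (M * ιMulti 𝕜 r v) N = mvInner (ιMulti 𝕜 r v) C) :
    leftContraction M N = C := by
  refine ((existsUnique_leftContraction M N).choose_spec.2 C fun L => ?_).symm
  rw [← mvInner_leftContraction]
  simpa using mvInner_left_ext (N'' := 0) 0
    (fun r v => by rw [← h, ← mvInner_leftContraction]; simp) L

variable {p q r : ℕ} {A B D H : ExteriorAlgebra 𝕜 X}

theorem leftContraction_mul_of_isOrtho (hA : IsBlade p A) (hA0 : A ≠ 0) (hD : IsBlade p D)
    (hH : IsBlade r H) (hH0 : H ≠ 0) (hAH : bladeSpace A ⟂ bladeSpace H) :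
    leftContraction A (D * H) = mvInner A D • H :=
  leftContraction_eq_of_forall_ιMulti fun _ v => by
    rw [mvInner_smul_right, mvInner_mul_mul_of_isOrtho hA hA0 hD hH hH0 (isBlade_ιMulti v) hAH]

theorem rightContraction_eq_smul_leftContraction (hA : IsBlade p A) (hB : IsBlade q B) :
    rightContraction B A = (-1 : 𝕜) ^ (p * (q - p)) • leftContraction A B := by
  have leftContraction_eq_smul :
      leftContraction A B = (-1 : 𝕜) ^ (p * (q - p)) • rightContraction B A := by
    refine leftContraction_eq_of_forall_ιMulti fun r v => ?_
    have hv := isBlade_ιMulti (𝕜 := 𝕜) v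
    rw [mvInner_smul_right, mvInner_rightContraction]
    rcases eq_or_ne (p + r) q with rfl | hpq
    · rw [hA.mul_comm hv, Nat.add_sub_cancel_left, mvInner_smul_left]
      simp
    · rw [mvInner_eq_zero_of_ne hpq (hA.mul hv) hB,
        mvInner_eq_zero_of_ne (by omega) (hv.mul hA) hB, mul_zero]
  rw [leftContraction_eq_smul, smul_smul, ← mul_pow, neg_one_mul, neg_neg, one_pow, one_smul]

end Contraction

section Map

variable {Y : Type*} [NormedAddCommGroup Y] [InnerProductSpace 𝕜 Y] {p : ℕ}
  {A : ExteriorAlgebra 𝕜 X} {T : X →ₗ[𝕜] Y}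

theorem IsBlade.map (hA : IsBlade p A) (T : X →ₗ[𝕜] Y) : IsBlade p (ExteriorAlgebra.map T A) := by
  obtain ⟨c, v, rfl⟩ := hA
  exact ⟨c, T ∘ v, by rw [map_smul, map_apply_ιMulti]⟩

theorem IsBlade.map_ne_zero_iff (hA : IsBlade p A) (hA0 : A ≠ 0) :
    ExteriorAlgebra.map T A ≠ 0 ↔ Disjoint (bladeSpace A) T.ker := by
  obtain ⟨c, v, hc, hv, rfl⟩ := hA.exists_linearIndependent hA0
  rw [bladeSpace_eq_span hA0, map_smul, map_apply_ιMulti, smul_ne_zero_iff, ιMulti_ne_zero_iff]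
  exact ⟨fun h => (Submodule.range_ker_disjoint h.2), fun h => ⟨hc, hv.map h⟩⟩

theorem bladeSpace_map (hA : IsBlade p A) (hTA : ExteriorAlgebra.map T A ≠ 0) :
    bladeSpace (ExteriorAlgebra.map T A) = (bladeSpace A).map T := by
  have hA0 : A ≠ 0 := by
    rintro rfl
    exact hTA (map_zero _)
  obtain ⟨c, v, rfl⟩ := hA
  rw [map_smul, map_apply_ιMulti] at hTA ⊢
  rw [bladeSpace_eq_span hTA, bladeSpace_eq_span hA0, Submodule.map_span, Set.range_comp]

theorem mvInner_map_left {S : Y →ₗ[𝕜] X} (hTS : ∀ x y, ⟪T x, y⟫_𝕜 = ⟪x, S y⟫_𝕜)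
    (M : ExteriorAlgebra 𝕜 X) (N : ExteriorAlgebra 𝕜 Y) :
    mvInner (ExteriorAlgebra.map T M) N = mvInner M (ExteriorAlgebra.map S N) := by
  have comp_eq : mvInnerₛₗ.comp (ExteriorAlgebra.map T).toLinearMap =
      mvInnerₛₗ.compl₂ (ExteriorAlgebra.map S).toLinearMap := by
    refine LinearMap.ext_on_range (ιMulti_span 𝕜 X) fun ⟨p, v⟩ => ?_
    ext q w
    change mvInner (ExteriorAlgebra.map T (ιMulti 𝕜 p v)) (ιMulti 𝕜 q w) =
      mvInner (ιMulti 𝕜 p v) (ExteriorAlgebra.map S (ιMulti 𝕜 q w))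
    rw [map_apply_ιMulti, map_apply_ιMulti]
    rcases eq_or_ne p q with rfl | hpq
    · simp only [mvInner_ιMulti, Function.comp_apply, hTS]
    · rw [mvInner_ιMulti_of_ne hpq, mvInner_ιMulti_of_ne hpq]
  exact LinearMap.congr_fun₂ comp_eq M N

end Map

section Proj

theorem map_starProjection_orthogonal_inf (V W : Submodule 𝕜 X) [W.HasOrthogonalProjection] :
    (V.map (W.starProjection : X →ₗ[𝕜] X))ᗮ ⊓ W = Vᗮ ⊓ W := by
  ext x
  simp only [Submodule.mem_inf, Submodule.mem_orthogonal, Submodule.mem_map,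
    forall_exists_index, and_imp, forall_apply_eq_imp_iff₂]
  refine and_congr_left fun hx => forall₂_congr fun y _ => ?_
  change ⟪W.starProjection y, x⟫_𝕜 = 0 ↔ _
  rw [Submodule.inner_starProjection_left_eq_right, Submodule.starProjection_eq_self_iff.mpr hx]

variable [FiniteDimensional 𝕜 X] {p : ℕ} {A : ExteriorAlgebra 𝕜 X} {W : Submodule 𝕜 X}

theorem mvInner_mvProj_left (M N : ExteriorAlgebra 𝕜 X) :
    mvInner (mvProj W M) N = mvInner M (mvProj W N) :=
  mvInner_map_left (W.inner_starProjection_left_eq_right) M N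

theorem isBlade_mvProj (hA : IsBlade p A) : IsBlade p (mvProj W A) :=
  hA.map _

theorem IsBlade.mvProj_eq_self (hA : IsBlade p A) (hAW : bladeSpace A ≤ W) : mvProj W A = A := by
  rcases eq_or_ne A 0 with rfl | hA0
  · exact map_zero _
  obtain ⟨c, v, rfl⟩ := hA
  rw [bladeSpace_eq_span hA0, Submodule.span_le, Set.range_subset_iff] at hAW
  rw [map_smul, mvProj, map_apply_ιMulti]
  congr 2
  ext i
  exact Submodule.starProjection_eq_self_iff.mpr (hAW i)

theorem IsBlade.mvProj_ne_zero_iff (hA : IsBlade p A) (hA0 : A ≠ 0) :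
    mvProj W A ≠ 0 ↔ ¬ PartiallyOrthogonal (bladeSpace A) W := by
  have ker_eq : (W.starProjection : X →ₗ[𝕜] X).ker = Wᗮ := W.ker_starProjection
  rw [mvProj, hA.map_ne_zero_iff hA0, ker_eq, PartiallyOrthogonal, not_not, disjoint_iff]

theorem bladeSpace_mvProj (hA : IsBlade p A) (hWA : mvProj W A ≠ 0) :
    bladeSpace (mvProj W A) = (bladeSpace A).map (W.starProjection : X →ₗ[𝕜] X) :=
  bladeSpace_map hA hWA

theorem bladeSpace_mvProj_le (hA : IsBlade p A) (hWA : mvProj W A ≠ 0) :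
    bladeSpace (mvProj W A) ≤ W := by
  rw [bladeSpace_mvProj hA hWA, Submodule.map_le_iff_le_comap]
  exact fun x _ => W.starProjection_apply_mem x

theorem orthogonal_bladeSpace_mvProj_inf (hA : IsBlade p A) (hWA : mvProj W A ≠ 0) :
    (bladeSpace (mvProj W A))ᗮ ⊓ W = (bladeSpace A)ᗮ ⊓ W := by
  rw [bladeSpace_mvProj hA hWA, map_starProjection_orthogonal_inf]

theorem mvProj_mvProj (M : ExteriorAlgebra 𝕜 X) :
    mvProj W (mvProj W M) = mvProj W M := by
  have comp_self : (W.starProjection : X →ₗ[𝕜] X) ∘ₗ (W.starProjection : X →ₗ[𝕜] X) =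
      (W.starProjection : X →ₗ[𝕜] X) :=
    LinearMap.ext fun x => Submodule.starProjection_eq_self_iff.mpr (W.starProjection_apply_mem x)
  rw [mvProj, ← AlgHom.comp_apply, map_comp_map, comp_self]

theorem mvNorm_mvProj_le (M : ExteriorAlgebra 𝕜 X) : mvNorm (mvProj W M) ≤ mvNorm M := by
  obtain ⟨N, hN⟩ : ∃ N, M = mvProj W M + N := ⟨M - mvProj W M, (add_sub_cancel _ _).symm⟩
  have mvProj_N : mvProj W N = 0 := by
    have h := congrArg (mvProj W) hN
    rwa [map_add, mvProj_mvProj, left_eq_add] at h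
  have pythagoras : mvInner M M = mvInner (mvProj W M) (mvProj W M) + mvInner N N := by
    conv_lhs => rw [hN]
    simp only [mvInner_add_left, mvInner_add_right]
    rw [mvInner_mvProj_left M N, mvProj_N, mvInner_zero_right, ← mvInner_mvProj_left N M, mvProj_N,
      mvInner_zero_left, add_zero, zero_add]
  rw [mvNorm, mvNorm, pythagoras, map_add]
  exact Real.sqrt_le_sqrt (le_add_of_nonneg_right (mvInner_self_nonneg N))

end Proj

section Factorization

variable {p q : ℕ} {A B D : ExteriorAlgebra 𝕜 X}

theorem range_append {α : Type*} (v : Fin p → α) (w : Fin q → α) :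
    Set.range (Fin.append v w) = Set.range v ∪ Set.range w := by
  rw [← finSumFinEquiv.surjective.range_comp, ← Set.Sum.elim_range, ← Fin.append_comp_sumElim]
  rfl

theorem bladeSpace_mul (hA : IsBlade p A) (hB : IsBlade q B) (hAB : A * B ≠ 0) :
    bladeSpace (A * B) = bladeSpace A ⊔ bladeSpace B := by
  have hA0 := left_ne_zero_of_mul hAB
  have hB0 := right_ne_zero_of_mul hAB
  obtain ⟨c, v, rfl⟩ := hA
  obtain ⟨d, w, rfl⟩ := hB
  rw [smul_mul_smul_comm, ιMulti_mul_ιMulti] at hAB ⊢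
  rw [bladeSpace_eq_span hAB, bladeSpace_eq_span hA0, bladeSpace_eq_span hB0,
    range_append, Submodule.span_union]

theorem exists_isBlade_bladeSpace_eq (U : Submodule 𝕜 X) [FiniteDimensional 𝕜 U]
    (hU : finrank 𝕜 U = p) :
    ∃ H : ExteriorAlgebra 𝕜 X, IsBlade p H ∧ H ≠ 0 ∧ bladeSpace H = U := by
  let b := finBasisOfFinrankEq 𝕜 U hU
  have hb : LinearIndependent 𝕜 fun i => (b i : X) :=
    b.linearIndependent.map' U.subtype U.ker_subtype
  exact ⟨_, isBlade_ιMulti _, ιMulti_ne_zero_iff.mpr hb,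
    (bladeSpace_ιMulti hb).trans (span_range_coe_basis b)⟩

theorem mul_ne_zero_of_isOrtho (hA : IsBlade p A) (hA0 : A ≠ 0) (hB : IsBlade q B) (hB0 : B ≠ 0)
    (hAB : bladeSpace A ⟂ bladeSpace B) : A * B ≠ 0 := by
  intro h
  have mvNorm_mul := mvNorm_mul_of_isOrtho hA hA0 hB hB0 hAB
  rw [h, mvNorm_zero] at mvNorm_mul
  exact (mul_pos (hA.mvNorm_pos hA0) (hB.mvNorm_pos hB0)).ne mvNorm_mul

theorem IsBlade.exists_eq_mul_of_le (hD : IsBlade p D) (hD0 : D ≠ 0) (hB : IsBlade q B)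
    (hB0 : B ≠ 0) (hDB : bladeSpace D ≤ bladeSpace B) :
    ∃ H, IsBlade (q - p) H ∧ bladeSpace H = (bladeSpace D)ᗮ ⊓ bladeSpace B ∧ B = D * H := by
  have := hD.finiteDimensional_bladeSpace hD0
  have := hB.finiteDimensional_bladeSpace hB0
  have finrank_add := Submodule.finrank_add_inf_finrank_orthogonal hDB
  rw [hD.finrank_bladeSpace hD0, hB.finrank_bladeSpace hB0] at finrank_add
  obtain ⟨r, rfl⟩ := Nat.exists_eq_add_of_le (Nat.le.intro finrank_add)
  rw [Nat.add_sub_cancel_left]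
  obtain ⟨H, hH, hH0, hHs⟩ := exists_isBlade_bladeSpace_eq ((bladeSpace D)ᗮ ⊓ bladeSpace B)
    (Nat.add_left_cancel finrank_add)
  have isOrtho : bladeSpace D ⟂ bladeSpace H := by
    rw [hHs, Submodule.isOrtho_comm]
    exact inf_le_left
  have hDH := mul_ne_zero_of_isOrtho hD hD0 hH hH0 isOrtho
  obtain ⟨k, hk0, hk⟩ := hB.exists_eq_smul_of_bladeSpace_eq hB0 (hD.mul hH) hDH <| by
    rw [bladeSpace_mul hD hH hDH, hHs,
      Submodule.sup_orthogonal_inf_of_hasOrthogonalProjection hDB]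
  exact ⟨k • H, hH.smul k, (bladeSpace_smul hH hH0 hk0).trans hHs, by rw [hk, mul_smul_comm]⟩

end Factorization

section Characterization

variable {p q r : ℕ} {A B C G : ExteriorAlgebra 𝕜 X}

theorem IsBlade.sameOrientation_map_iff_eq {T : ExteriorAlgebra 𝕜 X →ₗ[𝕜] ExteriorAlgebra 𝕜 X}
    (hG : IsBlade r G) (hB0 : B ≠ 0) (hTG : SameOrientation (T G) B) :
    (IsBlade r C ∧ bladeSpace C = bladeSpace G ∧ mvNorm C = mvNorm G ∧ SameOrientation (T C) B) ↔
      C = G := by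
  refine ⟨fun ⟨hC, hs, hn, k, hk, hTC⟩ => ?_, by rintro rfl; exact ⟨hG, rfl, rfl, hTG⟩⟩
  obtain ⟨l, hl, hTG⟩ := hTG
  have ne_zero_of_map_eq {M : ExteriorAlgebra 𝕜 X} {m : ℝ} (hm : 0 < m)
      (hTM : T M = (m : 𝕜) • B) : M ≠ 0 := by
    rintro rfl
    rw [map_zero] at hTM
    exact smul_ne_zero (RCLike.ofReal_ne_zero.mpr hm.ne') hB0 hTM.symm
  have hG0 := ne_zero_of_map_eq hl hTG
  obtain ⟨a, -, rfl⟩ := hC.exists_eq_smul_of_bladeSpace_eq (ne_zero_of_map_eq hk hTC) hG hG0 hs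
  have norm_a : ‖a‖ = 1 := by
    rw [mvNorm_smul] at hn
    exact (mul_eq_right₀ (hG.mvNorm_pos hG0).ne').mp hn
  have a_mul : a * l = k := by
    rw [map_smul, hTG, smul_smul] at hTC
    exact smul_left_injective 𝕜 hB0 hTC
  have hlk : l = k := by
    have := congrArg norm a_mul
    rwa [norm_mul, norm_a, one_mul, RCLike.norm_of_nonneg hl.le,
      RCLike.norm_of_nonneg hk.le] at this
  rw [hlk, mul_eq_right₀ (RCLike.ofReal_ne_zero.mpr hk.ne')] at a_mul
  rw [a_mul, one_smul]

variable [FiniteDimensional 𝕜 X]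

theorem leftContraction_eq_zero_of_mvProj_eq_zero {W : Submodule 𝕜 X}
    {M N : ExteriorAlgebra 𝕜 X} (hM : mvProj W M = 0) (hN : mvProj W N = N) :
    leftContraction M N = 0 :=
  leftContraction_eq_of_forall_ιMulti fun r v => by
    rw [← hN, ← mvInner_mvProj_left, map_mul, hM, zero_mul, mvInner_zero_left, mvInner_zero_right]

theorem IsBlade.le_of_mvProj_ne_zero (hA : IsBlade p A) (hB : IsBlade q B) (hB0 : B ≠ 0)
    (hBA : mvProj (bladeSpace B) A ≠ 0) : p ≤ q := by
  rw [← (isBlade_mvProj hA).finrank_bladeSpace hBA, ← hB.finrank_bladeSpace hB0]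
  exact Submodule.finrank_mono (bladeSpace_mvProj_le hA hBA)

theorem exists_leftContraction_eq_smul (hA : IsBlade p A) (hB : IsBlade q B) (hB0 : B ≠ 0)
    (hBA : mvProj (bladeSpace B) A ≠ 0) :
    ∃ H, IsBlade (q - p) H ∧ bladeSpace H = (bladeSpace A)ᗮ ⊓ bladeSpace B ∧
      B = mvProj (bladeSpace B) A * H ∧
      leftContraction A B = (mvNorm (mvProj (bladeSpace B) A) : 𝕜) ^ 2 • H := by
  have hD : IsBlade p (mvProj (bladeSpace B) A) := isBlade_mvProj hA
  obtain ⟨H, hH, hHs, hBDH⟩ := hD.exists_eq_mul_of_le hBA hB hB0 (bladeSpace_mvProj_le hA hBA)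
  rw [orthogonal_bladeSpace_mvProj_inf hA hBA] at hHs
  refine ⟨H, hH, hHs, hBDH, ?_⟩
  have hA0 : A ≠ 0 := by
    rintro rfl
    exact hBA (map_zero _)
  have isOrtho : bladeSpace A ⟂ bladeSpace H := by
    rw [hHs, Submodule.isOrtho_comm]
    exact inf_le_left
  have mvInner_mvProj : mvInner A (mvProj (bladeSpace B) A) =
      (mvNorm (mvProj (bladeSpace B) A) : 𝕜) ^ 2 := by
    rw [← hD.mvInner_self, mvInner_mvProj_left,
      hD.mvProj_eq_self (bladeSpace_mvProj_le hA hBA)]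
  conv_lhs => rw [hBDH]
  rw [leftContraction_mul_of_isOrtho hA hA0 hD hH (right_ne_zero_of_mul (hBDH ▸ hB0)) isOrtho,
    mvInner_mvProj]

theorem leftContraction_ne_zero (hA : IsBlade p A) (hB : IsBlade q B) (hB0 : B ≠ 0)
    (hBA : mvProj (bladeSpace B) A ≠ 0) : leftContraction A B ≠ 0 := by
  obtain ⟨H, -, -, hBDH, hAB⟩ := exists_leftContraction_eq_smul hA hB hB0 hBA
  rw [hAB]
  refine smul_ne_zero (pow_ne_zero 2 (RCLike.ofReal_ne_zero.mpr ?_))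
    (right_ne_zero_of_mul (hBDH ▸ hB0))
  exact ((isBlade_mvProj hA).mvNorm_pos hBA).ne'

theorem leftContraction_eq_zero_iff (hA : IsBlade p A) (hA0 : A ≠ 0) (hB : IsBlade q B)
    (hB0 : B ≠ 0) :
    leftContraction A B = 0 ↔ PartiallyOrthogonal (bladeSpace A) (bladeSpace B) := by
  rw [← not_iff_not, ← hA.mvProj_ne_zero_iff hA0]
  exact ⟨mt fun h => leftContraction_eq_zero_of_mvProj_eq_zero h (hB.mvProj_eq_self le_rfl),
    leftContraction_ne_zero hA hB hB0⟩

theorem isBlade_leftContraction (hA : IsBlade p A) (hB : IsBlade q B) (hB0 : B ≠ 0)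
    (hBA : mvProj (bladeSpace B) A ≠ 0) : IsBlade (q - p) (leftContraction A B) := by
  obtain ⟨H, hH, -, -, hAB⟩ := exists_leftContraction_eq_smul hA hB hB0 hBA
  exact hAB ▸ hH.smul _

theorem bladeSpace_leftContraction (hA : IsBlade p A) (hB : IsBlade q B) (hB0 : B ≠ 0)
    (hBA : mvProj (bladeSpace B) A ≠ 0) :
    bladeSpace (leftContraction A B) = (bladeSpace A)ᗮ ⊓ bladeSpace B := by
  obtain ⟨H, hH, hHs, hBDH, hAB⟩ := exists_leftContraction_eq_smul hA hB hB0 hBA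
  have hD := (isBlade_mvProj hA).mvNorm_pos hBA
  rw [hAB, bladeSpace_smul hH (right_ne_zero_of_mul (hBDH ▸ hB0)) (by simp [hD.ne']), hHs]

theorem mvNorm_leftContraction (hA : IsBlade p A) (hB : IsBlade q B) (hB0 : B ≠ 0)
    (hBA : mvProj (bladeSpace B) A ≠ 0) :
    mvNorm (leftContraction A B) = mvNorm (mvProj (bladeSpace B) A) * mvNorm B := by
  obtain ⟨H, hH, hHs, hBDH, hAB⟩ := exists_leftContraction_eq_smul hA hB hB0 hBA
  have hD : IsBlade p (mvProj (bladeSpace B) A) := isBlade_mvProj hA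
  have isOrtho : bladeSpace (mvProj (bladeSpace B) A) ⟂ bladeSpace H := by
    rw [hHs, ← orthogonal_bladeSpace_mvProj_inf hA hBA, Submodule.isOrtho_comm]
    exact inf_le_left
  have mvNorm_eq : mvNorm B = mvNorm (mvProj (bladeSpace B) A) * mvNorm H := by
    conv_lhs => rw [hBDH]
    exact mvNorm_mul_of_isOrtho hD hBA hH (right_ne_zero_of_mul (hBDH ▸ hB0)) isOrtho
  rw [hAB, mvNorm_smul, norm_pow, RCLike.norm_of_nonneg (hD.mvNorm_pos hBA).le, mvNorm_eq]
  ring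

theorem sameOrientation_mvProj_mul_leftContraction (hA : IsBlade p A) (hB : IsBlade q B)
    (hB0 : B ≠ 0) (hBA : mvProj (bladeSpace B) A ≠ 0) :
    SameOrientation (mvProj (bladeSpace B) A * leftContraction A B) B := by
  obtain ⟨H, -, -, hBDH, hAB⟩ := exists_leftContraction_eq_smul hA hB hB0 hBA
  refine ⟨mvNorm (mvProj (bladeSpace B) A) ^ 2, pow_pos ((isBlade_mvProj hA).mvNorm_pos hBA) 2, ?_⟩
  rw [hAB, mul_smul_comm, ← hBDH, RCLike.ofReal_pow]

theorem rightContraction_eq_zero_iff (hA : IsBlade p A) (hB : IsBlade q B) :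
    rightContraction B A = 0 ↔ leftContraction A B = 0 := by
  rw [rightContraction_eq_smul_leftContraction hA hB, smul_eq_zero_iff_right (by simp)]

theorem isBlade_rightContraction (hA : IsBlade p A) (hB : IsBlade q B) (hB0 : B ≠ 0)
    (hBA : mvProj (bladeSpace B) A ≠ 0) : IsBlade (q - p) (rightContraction B A) := by
  rw [rightContraction_eq_smul_leftContraction hA hB]
  exact (isBlade_leftContraction hA hB hB0 hBA).smul _

theorem bladeSpace_rightContraction (hA : IsBlade p A) (hB : IsBlade q B) (hB0 : B ≠ 0)
    (hBA : mvProj (bladeSpace B) A ≠ 0) :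
    bladeSpace (rightContraction B A) = bladeSpace (leftContraction A B) := by
  rw [rightContraction_eq_smul_leftContraction hA hB]
  exact bladeSpace_smul (isBlade_leftContraction hA hB hB0 hBA)
    (leftContraction_ne_zero hA hB hB0 hBA) (by simp)

theorem mvNorm_rightContraction (hA : IsBlade p A) (hB : IsBlade q B) :
    mvNorm (rightContraction B A) = mvNorm (leftContraction A B) := by
  rw [rightContraction_eq_smul_leftContraction hA hB, mvNorm_smul, norm_pow, norm_neg, norm_one,
    one_pow, one_mul]

theorem rightContraction_mul_mvProj (hA : IsBlade p A) (hB : IsBlade q B) (hB0 : B ≠ 0)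
    (hBA : mvProj (bladeSpace B) A ≠ 0) :
    rightContraction B A * mvProj (bladeSpace B) A =
      mvProj (bladeSpace B) A * leftContraction A B := by
  rw [(isBlade_mvProj hA).mul_comm (isBlade_leftContraction hA hB hB0 hBA),
    rightContraction_eq_smul_leftContraction hA hB, smul_mul_assoc]

theorem eq_leftContraction_iff (hA : IsBlade p A) (hB : IsBlade q B) (hB0 : B ≠ 0)
    (hBA : mvProj (bladeSpace B) A ≠ 0) :
    (IsBlade (q - p) C ∧ bladeSpace C = (bladeSpace A)ᗮ ⊓ bladeSpace B ∧
      mvNorm C = mvNorm (mvProj (bladeSpace B) A) * mvNorm B ∧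
      SameOrientation (mvProj (bladeSpace B) A * C) B) ↔ C = leftContraction A B := by
  rw [← bladeSpace_leftContraction hA hB hB0 hBA, ← mvNorm_leftContraction hA hB hB0 hBA]
  exact (isBlade_leftContraction hA hB hB0 hBA).sameOrientation_map_iff_eq
    (T := LinearMap.mulLeft 𝕜 _) hB0 (sameOrientation_mvProj_mul_leftContraction hA hB hB0 hBA)

theorem eq_rightContraction_iff (hA : IsBlade p A) (hB : IsBlade q B) (hB0 : B ≠ 0)
    (hBA : mvProj (bladeSpace B) A ≠ 0) :
    (IsBlade (q - p) C ∧ bladeSpace C = (bladeSpace A)ᗮ ⊓ bladeSpace B ∧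
      mvNorm C = mvNorm (mvProj (bladeSpace B) A) * mvNorm B ∧
      SameOrientation (C * mvProj (bladeSpace B) A) B) ↔ C = rightContraction B A := by
  have sameOrientation : SameOrientation (rightContraction B A * mvProj (bladeSpace B) A) B := by
    rw [rightContraction_mul_mvProj hA hB hB0 hBA]
    exact sameOrientation_mvProj_mul_leftContraction hA hB hB0 hBA
  rw [← bladeSpace_leftContraction hA hB hB0 hBA, ← bladeSpace_rightContraction hA hB hB0 hBA,
    ← mvNorm_leftContraction hA hB hB0 hBA, ← mvNorm_rightContraction hA hB]
  exact (isBlade_rightContraction hA hB hB0 hBA).sameOrientation_map_iff_eq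
    (T := LinearMap.mulRight 𝕜 _) hB0 sameOrientation

end Characterization

section SingularVectors

variable {E F : Type*} [NormedAddCommGroup E] [InnerProductSpace 𝕜 E] [NormedAddCommGroup F]
  [InnerProductSpace 𝕜 F] [FiniteDimensional 𝕜 F]

theorem exists_orthonormalBasis_eq_norm_smul {ι κ : Type*} [Fintype κ]
    (hκ : finrank 𝕜 F = Fintype.card κ) {φ : ι → κ} (hφ : Function.Injective φ) {g : ι → F}
    (hg : Pairwise fun i j => ⟪g i, g j⟫_𝕜 = 0) :
    ∃ f : OrthonormalBasis κ 𝕜 F, ∀ i, g i = (‖g i‖ : 𝕜) • f (φ i) := by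
  let u : ι → F := fun i => ((‖g i‖⁻¹ : ℝ) : 𝕜) • g i
  let s : Set κ := φ '' {i | g i ≠ 0}
  have orthonormal_u : Orthonormal 𝕜 (s.domRestrict (Function.extend φ u 0)) := by
    constructor
    · rintro ⟨_, i, hi, rfl⟩
      simp [hφ.extend_apply, u, norm_smul, norm_ne_zero_iff.mpr hi]
    · rintro ⟨_, i, -, rfl⟩ ⟨_, j, -, rfl⟩
      intro hxy
      have hij : i ≠ j := fun h => hxy (by simp only [h])
      simp [hφ.extend_apply, u, inner_smul_left, inner_smul_right, hg hij]
  obtain ⟨f, hf⟩ := orthonormal_u.exists_orthonormalBasis_extension_of_card_eq hκ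
  refine ⟨f, fun i => ?_⟩
  by_cases hi : g i = 0
  · simp [hi]
  · rw [hf (φ i) ⟨i, hi, rfl⟩, hφ.extend_apply, smul_smul, ← RCLike.ofReal_mul,
      mul_inv_cancel₀ (norm_ne_zero_iff.mpr hi), RCLike.ofReal_one, one_smul]

variable [FiniteDimensional 𝕜 E]

theorem exists_orthonormalBasis_pairwise_inner_map_eq_zero {n : ℕ} (hn : finrank 𝕜 E = n)
    (S : E →ₗ[𝕜] F) :
    ∃ b : OrthonormalBasis (Fin n) 𝕜 E,
      (Pairwise fun i j => ⟪S (b i), S (b j)⟫_𝕜 = 0) ∧ Antitone fun i => ‖S (b i)‖ := by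
  have hT : (S.adjoint ∘ₗ S).IsSymmetric := S.isSymmetric_adjoint_comp_self
  let b := hT.eigenvectorBasis hn
  have inner_map (i j) :
      ⟪S (b i), S (b j)⟫_𝕜 = hT.eigenvalues hn j * ⟪b i, b j⟫_𝕜 := by
    have apply_b : (S.adjoint ∘ₗ S) (b j) = (hT.eigenvalues hn j : 𝕜) • b j :=
      hT.apply_eigenvectorBasis hn j
    rw [← LinearMap.adjoint_inner_right, ← LinearMap.comp_apply, apply_b, inner_smul_right]
  have norm_sq_map (i) : ‖S (b i)‖ ^ 2 = hT.eigenvalues hn i := by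
    have h := inner_map i i
    rw [inner_self_eq_norm_sq_to_K, b.inner_eq_one, mul_one] at h
    exact_mod_cast h
  refine ⟨b, fun i j hij => ?_, fun i j hij => ?_⟩
  · change ⟪S (b i), S (b j)⟫_𝕜 = 0
    rw [inner_map, b.inner_eq_zero hij, mul_zero]
  · rw [← sq_le_sq₀ (norm_nonneg _) (norm_nonneg _), norm_sq_map, norm_sq_map]
    exact hT.eigenvalues_antitone hn hij

theorem exists_orthonormalBasis_map_eq_smul {m n : ℕ} (hm : finrank 𝕜 E = m)
    (hn : finrank 𝕜 F = n) (hmn : m ≤ n) (S : E →ₗ[𝕜] F) :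
    ∃ (b : OrthonormalBasis (Fin m) 𝕜 E) (f : OrthonormalBasis (Fin n) 𝕜 F) (σ : Fin m → ℝ),
      Antitone σ ∧ 0 ≤ σ ∧ ∀ i, S (b i) = (σ i : 𝕜) • f (Fin.castLE hmn i) := by
  obtain ⟨b, hb, hσ⟩ := exists_orthonormalBasis_pairwise_inner_map_eq_zero hm S
  obtain ⟨f, hf⟩ := exists_orthonormalBasis_eq_norm_smul (by rw [hn, Fintype.card_fin])
    (Fin.castLE_injective hmn) hb
  exact ⟨b, f, _, hσ, fun _ => norm_nonneg _, hf⟩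

end SingularVectors

section PrincipalBases

variable {p q : ℕ} {V W : Submodule 𝕜 X}

theorem exists_isPrincipalBases [FiniteDimensional 𝕜 V] [FiniteDimensional 𝕜 W]
    (hV : finrank 𝕜 V = p) (hW : finrank 𝕜 W = q) (hpq : p ≤ q) :
    ∃ (e : Fin p → X) (f : Fin q → X), IsPrincipalBases V W e f := by
  obtain ⟨e, f, σ, hσ, hσ0, he⟩ := exists_orthonormalBasis_map_eq_smul hV hW hpq
    ((W.orthogonalProjectionOnto : X →ₗ[𝕜] W) ∘ₗ V.subtype)
  have inner_e_f (i) (j) :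
      ⟪(e i : X), (f j : X)⟫_𝕜 = if (i : ℕ) = j then (σ i : 𝕜) else 0 := by
    have h : ⟪(e i : X), (f j : X)⟫_𝕜 = ⟪(σ i : 𝕜) • f (Fin.castLE hpq i), f j⟫_𝕜 := by
      rw [← he i]
      exact (Submodule.inner_orthogonalProjectionOnto_eq_of_mem_right (f j) (e i : X)).symm
    rw [h, inner_smul_left, orthonormal_iff_ite.mp f.orthonormal, RCLike.conj_ofReal]
    simp [Fin.ext_iff]
  refine ⟨fun i => e i, fun j => f j, ?_, span_range_coe_basis e.toBasis, ?_,
    span_range_coe_basis f.toBasis, ?_, ?_, ?_⟩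
  · exact e.orthonormal.comp_linearIsometry V.subtypeₗᵢ
  · exact f.orthonormal.comp_linearIsometry W.subtypeₗᵢ
  · intro i j hij
    rw [inner_e_f, if_neg hij]
  · intro i j hij
    rw [inner_e_f, if_pos hij, RCLike.ofReal_re, RCLike.ofReal_im]
    exact ⟨hσ0 i, rfl⟩
  · intro i j hij
    simp only [pairAngle, inner_e_f, Fin.val_castLE, if_true, RCLike.ofReal_re]
    exact Real.arccos_le_arccos (hσ hij)

end PrincipalBases

section Angle

variable {p q : ℕ}

theorem exists_isPOFactorization {A B : ExteriorAlgebra 𝕜 X} (hA : IsBlade p A) (hA0 : A ≠ 0)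
    (hB : IsBlade q B) (hB0 : B ≠ 0) (hpq : p ≤ q) : ∃ P Q, IsPOFactorization A B P Q := by
  have := hA.finiteDimensional_bladeSpace hA0
  have := hB.finiteDimensional_bladeSpace hB0
  obtain ⟨e, f, h⟩ := exists_isPrincipalBases (hA.finrank_bladeSpace hA0)
    (hB.finrank_bladeSpace hB0) hpq
  obtain ⟨ε, hε, hBf⟩ := hB.exists_eq_mvNorm_smul_ιMulti hB0 h.orthonormal_right h.span_right
  refine ⟨_, _, p, q, e, f, ε, h, hε, rfl, rfl, ?_⟩
  conv_lhs => rw [hBf]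
  rw [smul_mul_assoc, ιMulti_mul_ιMulti,
    ← ιMulti_comp_cast (Nat.add_sub_cancel' (min_le_right p q))]
  congr 2
  ext i
  refine Fin.addCases (fun j => ?_) (fun j => ?_) i
  · rw [Fin.append_left]
    rfl
  · rw [Fin.append_right]
    rfl

namespace IsPrincipalBases

variable {V W : Submodule 𝕜 X} {e : Fin p → X} {f : Fin q → X}

theorem starProjection_apply [W.HasOrthogonalProjection] (h : IsPrincipalBases V W e f)
    (hpq : p ≤ q) (i : Fin p) :
    W.starProjection (e i) = ⟪f (Fin.castLE hpq i), e i⟫_𝕜 • f (Fin.castLE hpq i) := by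
  refine Submodule.eq_starProjection_of_mem_of_inner_eq_zero
    (Submodule.smul_mem _ _ (h.span_right ▸ Submodule.subset_span ⟨_, rfl⟩)) ?_
  rw [← h.span_right]
  refine fun w hw => Submodule.span_induction ?_ ?_ ?_ ?_ hw
  · rintro _ ⟨j, rfl⟩
    rw [inner_sub_left, inner_smul_left, inner_conj_symm,
      orthonormal_iff_ite.mp h.orthonormal_right]
    rcases eq_or_ne (Fin.castLE hpq i) j with rfl | hij
    · simp
    · rw [if_neg hij, mul_zero, sub_zero]
      exact h.inner_eq_zero i j fun hij' => hij (Fin.ext hij')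
  · exact inner_zero_right _
  · intro x y _ _ hx hy
    rw [inner_add_right, hx, hy, add_zero]
  · intro c x _ hx
    rw [inner_smul_right, hx, mul_zero]

theorem mvProj_ιMulti [FiniteDimensional 𝕜 X] (h : IsPrincipalBases V W e f) (hpq : p ≤ q) :
    mvProj W (ιMulti 𝕜 p e) =
      (∏ i, ⟪f (Fin.castLE hpq i), e i⟫_𝕜) • ιMulti 𝕜 p (f ∘ Fin.castLE hpq) := by
  rw [mvProj, map_apply_ιMulti, ← AlternatingMap.map_smul_univ]
  congr 1
  ext i
  exact h.starProjection_apply hpq i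

end IsPrincipalBases

variable [FiniteDimensional 𝕜 X] {A B P Q : ExteriorAlgebra 𝕜 X}

theorem IsPOFactorization.norm_mvInner (h : IsPOFactorization A B P Q) (hA : IsBlade p A)
    (hA0 : A ≠ 0) (hB : IsBlade q B) (hB0 : B ≠ 0) (hpq : p ≤ q) :
    ‖mvInner A P‖ = mvNorm (mvProj (bladeSpace B) A) * mvNorm B := by
  obtain ⟨m, n, e, f, ε, hef, hε, rfl, -, -⟩ := h
  have linearIndependent_e := hef.orthonormal_left.linearIndependent
  have linearIndependent_f := hef.orthonormal_right.linearIndependent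
  obtain rfl := hA.eq_of_span_eq_bladeSpace hA0 linearIndependent_e hef.span_left
  obtain rfl := hB.eq_of_span_eq_bladeSpace hB0 linearIndependent_f hef.span_right
  have hf := hef.orthonormal_right.comp _ (Fin.castLE_injective hpq)
  have ιMulti_min : ιMulti 𝕜 (min m n) (fun i => f (Fin.castLE (min_le_right m n) i)) =
      ιMulti 𝕜 m (f ∘ Fin.castLE hpq) :=
    ιMulti_comp_cast (min_eq_left hpq) (f ∘ Fin.castLE hpq)
  obtain ⟨c, -, hAe⟩ := hA.exists_eq_smul_ιMulti hA0 linearIndependent_e hef.span_left.symm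
  obtain ⟨s, hs⟩ : ∃ s : 𝕜, mvProj (bladeSpace B) A = s • ιMulti 𝕜 m (f ∘ Fin.castLE hpq) :=
    ⟨_, by rw [hAe, map_smul, hef.mvProj_ιMulti hpq, smul_smul]⟩
  have mvProj_f : mvProj (bladeSpace B) (ιMulti 𝕜 m (f ∘ Fin.castLE hpq)) =
      ιMulti 𝕜 m (f ∘ Fin.castLE hpq) := by
    refine (isBlade_ιMulti _).mvProj_eq_self ?_
    rw [bladeSpace_ιMulti hf.linearIndependent, ← hef.span_right]
    exact Submodule.span_mono (Set.range_comp_subset_range _ _)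
  rw [ιMulti_min, mvInner_smul_right, ← mvProj_f, ← mvInner_mvProj_left, hs, mvInner_smul_left,
    mvInner_ιMulti_self_of_orthonormal hf, mvNorm_smul, mvNorm_ιMulti_of_orthonormal hf]
  simp [hε, abs_of_nonneg (mvNorm_nonneg B), mul_comm]

theorem mvNorm_mul_cos_asymmetricAngle (hA : IsBlade p A) (hA0 : A ≠ 0) (hB : IsBlade q B)
    (hB0 : B ≠ 0) (hpq : p ≤ q) :
    mvNorm A * mvNorm B * Real.cos (asymmetricAngle A B) =
      mvNorm (mvProj (bladeSpace B) A) * mvNorm B := by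
  have factorization_exists := exists_isPOFactorization hA hA0 hB hB0 hpq
  obtain ⟨Q, hPQ⟩ := factorization_exists.choose_spec
  have norms_pos : 0 < mvNorm A * mvNorm B := mul_pos (hA.mvNorm_pos hA0) (hB.mvNorm_pos hB0)
  have le_mul : mvNorm (mvProj (bladeSpace B) A) * mvNorm B ≤ mvNorm A * mvNorm B :=
    mul_le_mul_of_nonneg_right (mvNorm_mvProj_le A) (mvNorm_nonneg B)
  have nonneg : 0 ≤ mvNorm (mvProj (bladeSpace B) A) * mvNorm B :=
    mul_nonneg (mvNorm_nonneg _) (mvNorm_nonneg B)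
  rw [asymmetricAngle, dif_pos factorization_exists, hPQ.norm_mvInner hA hA0 hB hB0 hpq,
    Real.cos_arccos (neg_one_lt_zero.le.trans (div_nonneg nonneg norms_pos.le))
      ((div_le_one norms_pos).mpr le_mul), mul_div_cancel₀ _ norms_pos.ne']

end Angle

end Grassmann

theorem mainTheorem2 {𝕜 X : Type*} [RCLike 𝕜] [NormedAddCommGroup X] [InnerProductSpace 𝕜 X]
    [FiniteDimensional 𝕜 X] (p q : ℕ) (A B : ExteriorAlgebra 𝕜 X)
    (hA : IsBlade p A) (hA0 : A ≠ 0) (hB : IsBlade q B) (hB0 : B ≠ 0) :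
    (PartiallyOrthogonal (bladeSpace A) (bladeSpace B) ↔
      leftContraction A B = 0 ∧ rightContraction B A = 0) ∧
    (¬ PartiallyOrthogonal (bladeSpace A) (bladeSpace B) →
      p ≤ q ∧
      mvNorm A * mvNorm B * Real.cos (asymmetricAngle A B) =
        mvNorm (mvProj (bladeSpace B) A) * mvNorm B ∧
      (∀ C : ExteriorAlgebra 𝕜 X,
        (IsBlade (q - p) C ∧
          bladeSpace C = (bladeSpace A)ᗮ ⊓ bladeSpace B ∧
          mvNorm C = mvNorm A * mvNorm B * Real.cos (asymmetricAngle A B) ∧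
          SameOrientation (mvProj (bladeSpace B) A * C) B) ↔
        C = leftContraction A B) ∧
      (∀ C : ExteriorAlgebra 𝕜 X,
        (IsBlade (q - p) C ∧
          bladeSpace C = (bladeSpace A)ᗮ ⊓ bladeSpace B ∧
          mvNorm C = mvNorm A * mvNorm B * Real.cos (asymmetricAngle A B) ∧
          SameOrientation (C * mvProj (bladeSpace B) A) B) ↔
        C = rightContraction B A)) := by
  refine ⟨?_, fun h => ?_⟩
  · rw [rightContraction_eq_zero_iff hA hB, and_self, leftContraction_eq_zero_iff hA hA0 hB hB0]
  · have hBA : mvProj (bladeSpace B) A ≠ 0 := (hA.mvProj_ne_zero_iff hA0).mpr h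
    have hpq : p ≤ q := hA.le_of_mvProj_ne_zero hB hB0 hBA
    rw [mvNorm_mul_cos_asymmetricAngle hA hA0 hB hB0 hpq]
    exact ⟨hpq, rfl, fun _ => eq_leftContraction_iff hA hB hB0 hBA,
      fun _ => eq_rightContraction_iff hA hB hB0 hBA⟩
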